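/- Conventions. Trees are sets of finite binary sequences, $[T]$ denotes the set of infinite branches of $T$, and $V$ is the ground model. An $E_0$ tree is a set $p\subseteq 2^{<\omega}$ for which there are $s\in 2^{<\omega}$ and finite binary sequences $t_k^0\neq t_k^1$ with $|t_k^0|=|t_k^1|$ $(k\in\omega)$ such that $p$ is the set of all initial segments of sequences $s^\frown t_0^{x(0)\,\frown}\cdots{}^\frown t_{n-1}^{x(n-1)}$, where $x\in 2^\omega$ and $n\in\omega$. $E_0$ forcing is the set of all $E_0$ trees ordered by inclusion. A willow tree is given by an infinite family $A$ of pairwise disjoint nonempty finite subsets of $\omega$ and a function $f:\omega\setminus\bigcup A\to 2$; it consists of all $u\in 2^{<\omega}$ that agree with $f$ on $\mathrm{dom}(u)\cap\mathrm{dom}(f)$ and are constant on $a\cap\mathrm{dom}(u)$ for every $a\in A$. Willow forcing $\mathbb{W}$ is the set of all willow trees ordered by inclusion. A set $X\subseteq 2^\omega$ is $\mathbb{W}$-small if every willow tree $T$ contains a willow tree $S\subseteq T$ with $[S]\cap X=\emptyset$. A real $r\in 2^\omega$ in an extension of $V$ is a $\mathbb{W}$ quasi-generic over $V$ if $r\notin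 B_c$ for every Borel code $c\in V$ for which $B_c$ (computed in $V$) is $\mathbb{W}$-small in $V$; here $r\notin B_c$ refers to the Borel set with code $c$ as computed in the extension. Theorem. Single-step $E_0$ forcing does not add $\mathbb{W}$ quasi-generics: if $G$ is $E_0$-generic over $V$, then no real $r\in 2^\omega\cap V[G]$ is a $\mathbb{W}$ quasi-generic over $V$. Equivalently, there are no $E_0$ tree $p$ and no $E_0$-name $\dot x$ for an element of $2^\omega$ such that $p$ forces $\dot x$ to be a $\mathbb{W}$ quasi-generic over $V$. -/

import Mathlib

namespace E0Willow

/-! ## The Cantor space and trees of finite binary sequences -/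

/-- The Cantor space of infinite binary sequences. -/
abbrev Cantor : Type := ℕ → Bool

/-- The initial segment of length `n` of an infinite binary sequence. -/
def initSeg (x : Cantor) (n : ℕ) : List Bool := (List.range n).map x

/-- The set `[T]` of infinite branches of a set `T` of finite binary sequences. -/
def branches (T : Set (List Bool)) : Set Cantor := {x | ∀ n, initSeg x n ∈ T}

/-! ## `E₀` forcing -/

/-- The finite sequence `s ⌢ t 0 (x 0) ⌢ ... ⌢ t (n - 1) (x (n - 1))`. -/
def e0Word (s : List Bool) (t : ℕ → Bool → List Bool) (x : Cantor) (n : ℕ) : List Bool :=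
  s ++ ((List.range n).map (fun k => t k (x k))).flatten

/-- `p` is an `E₀` tree: there are a finite binary sequence `s` and pairs `t k 0 ≠ t k 1` of finite
binary sequences of the same length such that `p` consists of all initial segments of the
sequences `s ⌢ t 0 (x 0) ⌢ ... ⌢ t (n - 1) (x (n - 1))`. -/
def IsE0Tree (p : Set (List Bool)) : Prop :=
  ∃ (s : List Bool) (t : ℕ → Bool → List Bool),
    (∀ k, (t k false).length = (t k true).length ∧ t k false ≠ t k true) ∧
    p = {u | ∃ (x : Cantor) (n : ℕ), u <+: e0Word s t x n}

/-- `E₀` forcing: all `E₀` trees, ordered by inclusion (smaller trees are stronger conditions). -/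
abbrev E0Forcing : Type := {p : Set (List Bool) // IsE0Tree p}

/-! ## Willow trees and willow null sets -/

/-- `T` is a willow tree: there are an infinite family `A` of pairwise disjoint, nonempty finite
sets of natural numbers and a function `f` from the complement of `⋃ A` to `{0, 1}` such that `T`
consists of the finite binary sequences which agree with `f` wherever both are defined and which
are constant on (the part in their domain of) every member of `A`. -/
def IsWillowTree (T : Set (List Bool)) : Prop :=
  ∃ (A : Set (Finset ℕ)) (f : {n : ℕ // ∀ a ∈ A, n ∉ a} → Bool),
    A.Infinite ∧ (∀ a ∈ A, a.Nonempty) ∧ A.PairwiseDisjoint id ∧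
    T = {u | (∀ (n : ℕ) (hn : ∀ a ∈ A, n ∉ a) (hu : n < u.length), u[n] = f ⟨n, hn⟩) ∧
      ∀ a ∈ A, ∀ m ∈ a, ∀ n ∈ a, ∀ (hm : m < u.length) (hn : n < u.length), u[m] = u[n]}

/-- `X` is willow null (willow small): every willow tree contains a willow tree whose set of
branches is disjoint from `X`. -/
def WillowNull (X : Set Cantor) : Prop :=
  ∀ T, IsWillowTree T → ∃ S, IsWillowTree S ∧ S ⊆ T ∧ Disjoint (branches S) X

/-! ## Borel codes, names for reals, and the forcing relation -/

/-- Codes for Borel subsets of the Cantor space. -/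
inductive BorelCode : Type
  | coord (n : ℕ) (b : Bool) : BorelCode
  | compl (c : BorelCode) : BorelCode
  | iUnion (c : ℕ → BorelCode) : BorelCode

/-- The Borel set, in the ground model, with a given code. -/
def BorelCode.decode : BorelCode → Set Cantor
  | .coord n b => {x | x n = b}
  | .compl c => (decode c)ᶜ
  | .iUnion c => ⋃ n, decode (c n)

/-- Nice `P`-names for elements of the Cantor space: `val n b` is the set of conditions attached to
the pair `(n, b)` in the name `{((n, b)ˇ, a) : a ∈ val n b}`; the two fields say that every
condition forces the interpretation of this name to be a total function from `ℕ` to `{0, 1}`. -/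
structure CantorName (P : Type) [Preorder P] where
  val : ℕ → Bool → Set P
  single_valued : ∀ n, ∀ a ∈ val n false, ∀ b ∈ val n true, ¬ ∃ r, r ≤ a ∧ r ≤ b
  total : ∀ n, ∀ p : P, ∃ r ≤ p, ∃ b, ∃ a ∈ val n b, r ≤ a

/-- `ForcesMem x c p` is `p ⊩ x ∈ B_c`, where `B_c` is the Borel set with code `c` as computed
in the generic extension. -/
def ForcesMem {P : Type} [Preorder P] (x : CantorName P) : BorelCode → P → Prop
  | .coord n b => fun p => ∀ q ≤ p, ∃ r ≤ q, ∃ a ∈ x.val n b, r ≤ a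
  | .compl c => fun p => ∀ q ≤ p, ¬ ForcesMem x c q
  | .iUnion c => fun p => ∀ q ≤ p, ∃ r ≤ q, ∃ n, ForcesMem x (c n) r

/-- `p` forces that `x` is quasi-generic over the ground model for the ideal of sets satisfying
`Null`: `x` lies outside every Borel set coded in the ground model whose ground model version
is null. -/
def ForcesQuasiGeneric {P : Type} [Preorder P] (Null : Set Cantor → Prop)
    (x : CantorName P) (p : P) : Prop :=
  ∀ c : BorelCode, Null c.decode → ForcesMem x c.compl p

/-- `P` adds a quasi-generic real for the ideal of sets satisfying `Null`: some condition forces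
that some real of the generic extension is quasi-generic over the ground model. -/
def AddsQuasiGeneric (P : Type) [Preorder P] (Null : Set Cantor → Prop) : Prop :=
  ∃ (x : CantorName P) (p : P), ForcesQuasiGeneric Null x p

end E0Willow

/-!
Below any condition there is an `E₀` tree along whose branches a given name for a real takes
continuously read values, and this tree can be chosen such that the values form a closed set which
does not include the set of branches of any willow tree.

*Continuous reading.* All the cones of an `E₀` tree above the nodes of one splitting level are
translates of one another, so a fusion (`exists_fusion`, `exists_common_tail`) thins the given
condition out to an `E₀` tree with letters `τ` whose cone at a word `w` of length `n` decides
the `n`-th digit of the name, as `d w` (`exists_continuous_reading`).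

*The obstruction.* Compare the values of the name in the pointwise order of `ℕ → Bool`. A second
fusion, now among words in the letters `τ`, makes incomparability of the values along two branches
depend only on the place where the branches split (`exists_splitting_homogeneous`): at each
splitting node either some incomparability can be reached, and is then decided by finitely many
digits, or there is none to be reached at all. So the graph of incomparability on the values is
put together by successive splittings with all or no edges between the two sides, and such a graph
has no induced path on four vertices (`no_path_of_splitting`). The branches of a willow tree do
have one: writing `⟨J⟩` for the branch which is `1` on the classes `a j` with `j ∈ J` and `0` on
all others, `⟨1⟩ - ⟨0⟩ - ⟨1,2⟩ - ⟨0,1⟩` is an induced path.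

*Conclusion.* The closed set `valueSet` of values of the name contains the branches of no willow
tree. A closed set with this property is willow null (`WillowNull.of_closed`), because a willow
tree one of whose branches is outside the set can be thinned out, by fixing finitely many of its
classes, to one all of whose branches are. The thinned out `E₀` tree forces the name into this set.
-/

namespace E0Willow

/-! ### Words over a sequence of pairs of letters -/

/-- Substitution of letters into a word: the sequence `t 0 (w 0) ⌢ t 1 (w 1) ⌢ ...`, taken over
the length of the word `w`. -/
def subst : (ℕ → Bool → List Bool) → List Bool → List Bool
  | _, [] => []
  | t, b :: w => t 0 b ++ subst (fun k => t (k + 1)) w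

/-- The sequence of pairs of letters with the first `n` pairs dropped. -/
def shift (t : ℕ → Bool → List Bool) (n : ℕ) : ℕ → Bool → List Bool := fun k => t (k + n)

/-- The requirement on the pairs of letters of an `E₀` tree. -/
def IsLetter (a : Bool → List Bool) : Prop :=
  (a false).length = (a true).length ∧ a false ≠ a true

/-- The `E₀` tree with stem `s` and letters `t`, with words in place of infinite sequences. -/
def tree (s : List Bool) (t : ℕ → Bool → List Bool) : Set (List Bool) :=
  {u | ∃ w, u <+: s ++ subst t w}

lemma IsLetter.length_eq {a : Bool → List Bool} (h : IsLetter a) (b c : Bool) :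
    (a b).length = (a c).length := by
  cases b <;> cases c <;> simp [h.1]

lemma IsLetter.length_pos {a : Bool → List Bool} (h : IsLetter a) (b : Bool) :
    0 < (a b).length := by
  rw [h.length_eq b false]
  by_contra h0
  have h1 : a false = [] := by simpa using h0
  have h2 : a true = [] := by
    rw [← List.length_eq_zero_iff, ← h.1, h1, List.length_nil]
  exact h.2 (h1.trans h2.symm)

lemma IsLetter.shift {t : ℕ → Bool → List Bool} (h : ∀ k, IsLetter (t k)) (n k : ℕ) :
    IsLetter (shift t n k) := h _

lemma shift_shift (t : ℕ → Bool → List Bool) (m n : ℕ) : shift (shift t m) n = shift t (n + m) := by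
  funext k
  simp [shift, add_assoc]

lemma shift_zero (t : ℕ → Bool → List Bool) : shift t 0 = t := rfl

lemma subst_nil (t : ℕ → Bool → List Bool) : subst t [] = [] := by simp [subst]

lemma subst_cons (t : ℕ → Bool → List Bool) (b : Bool) (w : List Bool) :
    subst t (b :: w) = t 0 b ++ subst (shift t 1) w := by rw [subst]; rfl

lemma subst_append (t : ℕ → Bool → List Bool) (v w : List Bool) :
    subst t (v ++ w) = subst t v ++ subst (shift t v.length) w := by
  induction v generalizing t with
  | nil => simp [subst_nil, shift_zero]
  | cons b v ih => simp [subst_cons, ih, shift_shift]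

lemma length_subst_eq {t : ℕ → Bool → List Bool} (ht : ∀ k, IsLetter (t k)) {v w : List Bool}
    (h : v.length = w.length) : (subst t v).length = (subst t w).length := by
  induction v generalizing t w with
  | nil => rw [List.length_eq_zero_iff.1 h.symm]
  | cons b v ih =>
    cases w with
    | nil => simp at h
    | cons c w =>
      simp only [subst_cons, List.length_append]
      rw [(ht 0).length_eq b c, ih (IsLetter.shift ht 1) (by simpa using h)]

lemma length_le_length_subst {t : ℕ → Bool → List Bool} (ht : ∀ k, IsLetter (t k))
    (w : List Bool) : w.length ≤ (subst t w).length := by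
  induction w generalizing t with
  | nil => simp
  | cons b w ih =>
    have h1 := ih (IsLetter.shift ht 1)
    have h2 := (ht 0).length_pos b
    simp only [subst_cons, List.length_append, List.length_cons]
    omega

lemma IsLetter.injective {a : Bool → List Bool} (h : IsLetter a) : Function.Injective a := by
  intro b c hbc
  cases b <;> cases c <;> first | rfl | exact absurd hbc h.2 | exact absurd hbc.symm h.2

lemma subst_injective {t : ℕ → Bool → List Bool} (ht : ∀ k, IsLetter (t k)) {v w : List Bool}
    (h : v.length = w.length) (hs : subst t v = subst t w) : v = w := by
  induction v generalizing t w with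
  | nil => exact (List.length_eq_zero_iff.1 h.symm).symm
  | cons b v ih =>
    cases w with
    | nil => simp at h
    | cons c w =>
      rw [subst_cons, subst_cons] at hs
      obtain ⟨h1, h2⟩ := List.append_inj hs ((ht 0).length_eq b c)
      rw [(ht 0).injective h1, ih (IsLetter.shift ht 1) (by simpa using h) h2]

/-! ### Trees given by a stem and letters -/

lemma initSeg_succ (x : Cantor) (n : ℕ) :
    initSeg x (n + 1) = x 0 :: initSeg (fun k => x (k + 1)) n := by
  simp [initSeg, List.range_succ_eq_map, Function.comp_def]

lemma e0Word_eq (s : List Bool) (t : ℕ → Bool → List Bool) (x : Cantor) (n : ℕ) :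
    e0Word s t x n = s ++ subst t (initSeg x n) := by
  have key : ∀ (n : ℕ) (t : ℕ → Bool → List Bool) (x : Cantor),
      ((List.range n).map (fun k => t k (x k))).flatten = subst t (initSeg x n) := by
    intro n
    induction n with
    | zero => intro t x; simp [initSeg, subst_nil]
    | succ n ih =>
      intro t x
      rw [initSeg_succ, subst_cons, ← ih]
      simp [List.range_succ_eq_map, Function.comp_def, shift]
  rw [e0Word, key]

lemma initSeg_getD (w : List Bool) : initSeg (fun k => w.getD k false) w.length = w := by
  apply List.ext_getElem
  · simp [initSeg]
  · intro i h1 h2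
    simp [initSeg, h2]

lemma tree_eq (s : List Bool) (t : ℕ → Bool → List Bool) :
    tree s t = {u | ∃ (x : Cantor) (n : ℕ), u <+: e0Word s t x n} := by
  ext u
  simp only [tree, Set.mem_ofPred_eq, e0Word_eq]
  constructor
  · rintro ⟨w, hw⟩
    exact ⟨_, w.length, by rwa [initSeg_getD]⟩
  · rintro ⟨x, n, h⟩
    exact ⟨_, h⟩

lemma isE0Tree_iff {p : Set (List Bool)} :
    IsE0Tree p ↔ ∃ s t, (∀ k, IsLetter (t k)) ∧ p = tree s t := by
  simp only [IsE0Tree, tree_eq, IsLetter]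

lemma isE0Tree_tree {s : List Bool} {t : ℕ → Bool → List Bool} (ht : ∀ k, IsLetter (t k)) :
    IsE0Tree (tree s t) := isE0Tree_iff.2 ⟨s, t, ht, rfl⟩

lemma stem_append_subst_mem (s : List Bool) (t : ℕ → Bool → List Bool) (w : List Bool) :
    s ++ subst t w ∈ tree s t := ⟨w, List.prefix_rfl⟩

lemma tree_of_prefix {s u v : List Bool} {t : ℕ → Bool → List Bool} (h : u <+: v)
    (hv : v ∈ tree s t) : u ∈ tree s t := by
  obtain ⟨w, hw⟩ := hv
  exact ⟨w, h.trans hw⟩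

lemma append_mem_tree_iff {l u : List Bool} {t : ℕ → Bool → List Bool} :
    l ++ u ∈ tree l t ↔ u ∈ tree [] t := by
  simp [tree, List.prefix_append_right_inj]

lemma tree_subset_iff {s : List Bool} {t : ℕ → Bool → List Bool} {s' : List Bool}
    {t' : ℕ → Bool → List Bool} :
    tree s t ⊆ tree s' t' ↔ ∀ w, s ++ subst t w ∈ tree s' t' := by
  constructor
  · exact fun h w => h (stem_append_subst_mem s t w)
  · rintro h u ⟨w, hw⟩
    exact tree_of_prefix hw (h w)

lemma tree_mono_tail {l : List Bool} {t t' : ℕ → Bool → List Bool} (h : tree [] t ⊆ tree [] t') :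
    tree l t ⊆ tree l t' := by
  rw [tree_subset_iff] at h ⊢
  intro w
  rw [append_mem_tree_iff]
  simpa using h w

lemma tree_cone_subset (s : List Bool) (t : ℕ → Bool → List Bool) (v : List Bool) :
    tree (s ++ subst t v) (shift t v.length) ⊆ tree s t := by
  rw [tree_subset_iff]
  intro w
  rw [List.append_assoc, ← subst_append]
  exact stem_append_subst_mem _ _ _

/-- Part of the stem of an `E₀` tree can be absorbed into its first pair of letters. -/
lemma exists_absorb_stem (s : List Bool) {t : ℕ → Bool → List Bool} (ht : ∀ k, IsLetter (t k)) :
    ∃ t' : ℕ → Bool → List Bool, (∀ k, IsLetter (t' k)) ∧ ∀ l, tree l t' ⊆ tree (l ++ s) t := by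
  refine ⟨fun k b => if k = 0 then s ++ t 0 b else t k b, ?_, ?_⟩
  · intro k
    rcases Nat.eq_zero_or_pos k with rfl | hk
    · simpa [IsLetter] using ht 0
    · simpa [IsLetter, hk.ne'] using ht k
  · intro l
    rw [tree_subset_iff]
    intro w
    cases w with
    | nil => exact ⟨[], by simp [subst_nil]⟩
    | cons b w =>
      refine ⟨b :: w, ?_⟩
      have : shift (fun k b => if k = 0 then s ++ t 0 b else t k b) 1 = shift t 1 := by
        funext k b
        simp [shift]
      simp [subst_cons, this]

/-- An `E₀` tree below a tree with stem `l` has a subtree with stem exactly `l`, whose tail can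
therefore be put above any other stem. -/
lemma exists_tail_of_subset {l s₁ : List Bool} {t t₁ : ℕ → Bool → List Bool}
    (h₁ : ∀ k, IsLetter (t₁ k)) (hsub : tree s₁ t₁ ⊆ tree l t) :
    ∃ t₂ : ℕ → Bool → List Bool, (∀ k, IsLetter (t₂ k)) ∧ tree [] t₂ ⊆ tree [] t ∧
      tree l t₂ ⊆ tree s₁ t₁ := by
  set z := List.replicate l.length false
  have hlen : l.length ≤ (s₁ ++ subst t₁ z).length := by
    have := length_le_length_subst h₁ z
    simp only [z, List.length_replicate, List.length_append] at this ⊢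
    omega
  obtain ⟨w, hw⟩ := hsub (stem_append_subst_mem s₁ t₁ z)
  obtain ⟨u, hu⟩ : l <+: s₁ ++ subst t₁ z :=
    List.prefix_of_prefix_length_le (List.prefix_append _ _) hw hlen
  obtain ⟨t₂, h₂, hs⟩ := exists_absorb_stem u (IsLetter.shift h₁ z.length)
  have hl : tree l t₂ ⊆ tree s₁ t₁ := by
    refine (hs l).trans ?_
    rw [hu]
    exact tree_cone_subset _ _ _
  refine ⟨t₂, h₂, ?_, hl⟩
  rw [tree_subset_iff]
  intro w
  rw [List.nil_append, ← append_mem_tree_iff (l := l)]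
  exact hsub (hl (stem_append_subst_mem _ _ _))

/-- Below every condition under an `E₀` tree there is one inside a cone of that tree at any given
splitting level. -/
lemma exists_subset_cone {t : ℕ → Bool → List Bool} (ht : ∀ k, IsLetter (t k)) (m : ℕ)
    {q : Set (List Bool)} (hq : IsE0Tree q) (hsub : q ⊆ tree [] t) :
    ∃ r, IsE0Tree r ∧ r ⊆ q ∧ ∃ w : List Bool, w.length = m ∧
      r ⊆ tree (subst t w) (shift t m) := by
  obtain ⟨s₁, t₁, h₁, rfl⟩ := isE0Tree_iff.1 hq
  have long : ∀ e ∈ tree [] t, ∃ w : List Bool, w.length = m ∧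
      ∃ w', e <+: subst t w ++ subst (shift t m) w' := by
    rintro e ⟨w, hw⟩
    set v := w ++ List.replicate m false
    have hv : (v.take m).length = m := by simp [v]
    refine ⟨v.take m, hv, v.drop m, ?_⟩
    have : subst t (v.take m) ++ subst (shift t m) (v.drop m) = subst t v := by
      conv_rhs => rw [← List.take_append_drop m v, subst_append, hv]
    rw [this]
    refine hw.trans ?_
    rw [List.nil_append, subst_append]
    exact List.prefix_append _ _
  set M := (subst t (List.replicate m false)).length
  have hM : ∀ w : List Bool, w.length = m → (subst t w).length = M := fun w hw =>
    length_subst_eq ht (by simp [hw])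
  set z := List.replicate M false
  set u := s₁ ++ subst t₁ z
  have hu : M ≤ u.length := by
    have := length_le_length_subst h₁ z
    simp only [z, u, List.length_replicate, List.length_append] at this ⊢
    omega
  have hr := tree_cone_subset s₁ t₁ z
  obtain ⟨w, hw, w', hw'⟩ := long u (hsub (stem_append_subst_mem _ _ _))
  have hwu : subst t w <+: u :=
    List.prefix_of_prefix_length_le (List.prefix_append _ _) hw' (by rw [hM w hw]; exact hu)
  refine ⟨_, isE0Tree_tree (IsLetter.shift h₁ z.length), hr, w, hw, ?_⟩
  rw [tree_subset_iff]
  intro v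
  obtain ⟨w₂, hw₂, w₃, hw₃⟩ := long _ (hsub (hr (stem_append_subst_mem _ _ v)))
  have h1 : subst t w <+: subst t w₂ ++ subst (shift t m) w₃ :=
    (hwu.trans (List.prefix_append _ _)).trans hw₃
  have h2 : subst t w = subst t w₂ := by
    refine (List.prefix_of_prefix_length_le h1 (List.prefix_append _ _) ?_).eq_of_length ?_ <;>
    simp [hM w hw, hM w₂ hw₂]
  exact ⟨w₃, by rw [h2]; exact hw₃⟩

/-! ### Fusion -/

/-- The fusion scheme: if at each stage a pair of letters and a next state can be chosen to suit
any finite set of nodes, then a sequence of letters can be chosen to suit all of the nodes which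
it generates. -/
lemma exists_fusion {σ : Type*} (x₀ : σ)
    (φ : ℕ → σ → List Bool → (Bool → List Bool) → σ → Prop)
    (step : ∀ n x (L : List (List Bool)), ∃ a x', IsLetter a ∧ ∀ l ∈ L, φ n x l a x') :
    ∃ (t : ℕ → Bool → List Bool) (xs : ℕ → σ), xs 0 = x₀ ∧ (∀ k, IsLetter (t k)) ∧
      ∀ w : List Bool, φ w.length (xs w.length) (subst t w) (t w.length) (xs (w.length + 1)) := by
  choose a x' ha hφ using step
  -- A stage consists of the current state and the list of all nodes of the current level.
  let stage : ℕ → σ × List (List Bool) := fun n => Nat.rec (x₀, [[]])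
    (fun n y => (x' n y.1 y.2,
      y.2.map (· ++ a n y.1 y.2 false) ++ y.2.map (· ++ a n y.1 y.2 true))) n
  let t : ℕ → Bool → List Bool := fun n => a n (stage n).1 (stage n).2
  have hmem : ∀ w : List Bool, subst t w ∈ (stage w.length).2 := by
    intro w
    induction w using List.reverseRecOn with
    | nil => simp [subst_nil, stage]
    | append_singleton w b ih =>
      have h1 : subst t (w ++ [b]) = subst t w ++ t w.length b := by
        simp [subst_append, subst_cons, subst_nil, shift]
      have h2 : (stage (w.length + 1)).2 = (stage w.length).2.map (· ++ t w.length false) ++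
        (stage w.length).2.map (· ++ t w.length true) := rfl
      rw [h1, List.length_append, List.length_singleton, h2, List.mem_append]
      cases b
      · exact Or.inl (List.mem_map.2 ⟨_, ih, rfl⟩)
      · exact Or.inr (List.mem_map.2 ⟨_, ih, rfl⟩)
  exact ⟨t, fun n => (stage n).1, rfl, fun k => ha _ _ _, fun w => hφ _ _ _ _ (hmem w)⟩

/-- Finitely many stems can be brought into an open dense set of conditions by thinning out their
common tail. -/
lemma exists_common_tail {D : Set (List Bool) → Prop}
    (anti : ∀ p q, q ⊆ p → D p → D q)
    (dense : ∀ p, IsE0Tree p → ∃ q, IsE0Tree q ∧ q ⊆ p ∧ D q)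
    {t : ℕ → Bool → List Bool} (ht : ∀ k, IsLetter (t k)) (L : List (List Bool)) :
    ∃ t' : ℕ → Bool → List Bool, (∀ k, IsLetter (t' k)) ∧ tree [] t' ⊆ tree [] t ∧
      ∀ l ∈ L, D (tree l t') := by
  induction L with
  | nil => exact ⟨t, ht, subset_rfl, by simp⟩
  | cons l L ih =>
    obtain ⟨t₁, h₁, hs₁, hD₁⟩ := ih
    obtain ⟨q, hq, hql, hDq⟩ := dense (tree l t₁) (isE0Tree_tree h₁)
    obtain ⟨s₂, t₂, h₂, rfl⟩ := isE0Tree_iff.1 hq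
    obtain ⟨t₃, h₃, hs₃, hl₃⟩ := exists_tail_of_subset h₂ hql
    refine ⟨t₃, h₃, hs₃.trans hs₁, ?_⟩
    intro l' hl'
    rcases List.mem_cons.1 hl' with rfl | hl'
    · exact anti _ _ hl₃ hDq
    · exact anti _ _ (tree_mono_tail hs₃) (hD₁ l' hl')

/-- Below every condition there is an `E₀` tree whose cones at the `n`-th splitting level all
belong to the `n`-th of countably many given open dense sets. -/
lemma exists_fusion_dense {D : ℕ → Set (List Bool) → Prop}
    (anti : ∀ n p q, q ⊆ p → D n p → D n q)
    (dense : ∀ n p, IsE0Tree p → ∃ q, IsE0Tree q ∧ q ⊆ p ∧ D n q)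
    {p : Set (List Bool)} (hp : IsE0Tree p) :
    ∃ τ : ℕ → Bool → List Bool, (∀ k, IsLetter (τ k)) ∧ tree [] τ ⊆ p ∧
      ∀ w : List Bool, D w.length (tree (subst τ w) (shift τ w.length)) := by
  obtain ⟨s₀, t₀, h₀, rfl⟩ := isE0Tree_iff.1 hp
  obtain ⟨t₁, h₁, hs₁⟩ := exists_absorb_stem s₀ h₀
  obtain ⟨τ, xs, hxs, hτ, H⟩ := exists_fusion
    (σ := {t : ℕ → Bool → List Bool // ∀ k, IsLetter (t k)}) ⟨t₁, h₁⟩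
    (fun n x l a x' => ∃ t : ℕ → Bool → List Bool, tree [] t ⊆ tree [] x.1 ∧
      D n (tree l t) ∧ a = t 0 ∧ x'.1 = shift t 1) (by
    intro n x L
    obtain ⟨t, ht, hs, hD⟩ := exists_common_tail (anti n) (dense n) x.2 L
    exact ⟨t 0, ⟨shift t 1, IsLetter.shift ht 1⟩, ht 0, fun l hl => ⟨t, hs, hD l hl, rfl, rfl⟩⟩)
  -- The tail of the fusion from stage `n` on lies in the tail reserved at stage `n`.
  have tail : ∀ (v : List Bool) (n : ℕ) (t : ℕ → Bool → List Bool), τ n = t 0 →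
      (xs (n + 1)).1 = shift t 1 → subst (shift τ n) v ∈ tree [] t := by
    intro v
    induction v with
    | nil => intro n t _ _; exact ⟨[], by simp [subst_nil]⟩
    | cons b v ih =>
      intro n t h1 h2
      have H' := H (List.replicate (n + 1) false)
      rw [List.length_replicate] at H'
      obtain ⟨t', hs', -, h1', h2'⟩ := H'
      obtain ⟨w, hw⟩ := hs' (ih (n + 1) t' h1' h2')
      refine ⟨b :: w, ?_⟩
      rw [subst_cons, shift_shift, subst_cons, ← h2, ← h1, add_comm 1 n, List.nil_append]
      have : shift τ n 0 = τ n := by simp [shift]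
      rw [this, List.prefix_append_right_inj]
      simpa using hw
  have cone : ∀ (n : ℕ) (t : ℕ → Bool → List Bool), τ n = t 0 →
      (xs (n + 1)).1 = shift t 1 → tree [] (shift τ n) ⊆ tree [] t := by
    intro n t h1 h2
    rw [tree_subset_iff]
    intro w
    exact tail w n t h1 h2
  refine ⟨τ, hτ, ?_, ?_⟩
  · obtain ⟨t, hs, -, h1, h2⟩ := H []
    have h3 : tree [] τ ⊆ tree [] t := cone 0 t h1 h2
    refine (h3.trans hs).trans ?_
    have h4 : xs ([] : List Bool).length = ⟨t₁, h₁⟩ := hxs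
    rw [h4]
    exact hs₁ []
  · intro w
    obtain ⟨t, -, hD, h1, h2⟩ := H w
    exact anti _ _ _ (tree_mono_tail (cone _ t h1 h2)) hD

/-- Continuous reading of names: below every condition there is an `E₀` tree whose cone at a word
`w` forces the digit of the name with index `w.length` to be `d w`. -/
lemma exists_continuous_reading (x : CantorName E0Forcing) (p : E0Forcing) :
    ∃ (τ : ℕ → Bool → List Bool) (d : List Bool → Bool), (∀ k, IsLetter (τ k)) ∧
      tree [] τ ⊆ p.1 ∧
      ∀ w : List Bool, ∃ a ∈ x.val w.length (d w), tree (subst τ w) (shift τ w.length) ⊆ a.1 := by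
  obtain ⟨τ, hτ, hp, H⟩ := exists_fusion_dense
    (D := fun n q => ∃ b, ∃ a ∈ x.val n b, q ⊆ a.1)
    (by
      rintro n p q hqp ⟨b, a, ha, hpa⟩
      exact ⟨b, a, ha, hqp.trans hpa⟩)
    (by
      intro n p hp
      obtain ⟨r, hr, b, a, ha, hra⟩ := x.total n ⟨p, hp⟩
      exact ⟨r.1, r.2, hr, b, a, ha, hra⟩) p.2
  choose d hd using H
  exact ⟨τ, d, hτ, hp, hd⟩

/-! ### Incomparability of values -/

/-- The digits `d` read along the words `v` and `v'` are incomparable in the pointwise order. A word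
decides the digits with index up to and including its length. -/
def Incomp (d : List Bool → Bool) (v v' : List Bool) : Prop :=
  ∃ i j, (i ≤ v.length ∧ i ≤ v'.length ∧ d (v.take i) = true ∧ d (v'.take i) = false) ∧
    (j ≤ v.length ∧ j ≤ v'.length ∧ d (v.take j) = false ∧ d (v'.take j) = true)

lemma Incomp.symm {d : List Bool → Bool} {v v' : List Bool} (h : Incomp d v v') :
    Incomp d v' v := by
  obtain ⟨i, j, ⟨h1, h2, h3, h4⟩, ⟨h5, h6, h7, h8⟩⟩ := h
  exact ⟨j, i, ⟨h6, h5, h8, h7⟩, ⟨h2, h1, h4, h3⟩⟩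

lemma Incomp.irrefl {d : List Bool → Bool} {v : List Bool} : ¬ Incomp d v v := by
  rintro ⟨i, j, ⟨-, -, h3, h4⟩, -⟩
  simp [h3] at h4

lemma Incomp.append {d : List Bool → Bool} {v v' : List Bool} (h : Incomp d v v')
    (u u' : List Bool) : Incomp d (v ++ u) (v' ++ u') := by
  obtain ⟨i, j, ⟨h1, h2, h3, h4⟩, ⟨h5, h6, h7, h8⟩⟩ := h
  refine ⟨i, j, ⟨?_, ?_, ?_, ?_⟩, ⟨?_, ?_, ?_, ?_⟩⟩ <;>
    first
    | (rw [List.take_append_of_le_length (by assumption)]; assumption)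
    | (rw [List.length_append]; omega)

/-- Whether values are incomparable is the same for all pairs of branches that split between
`l ⌢ a 0` and `l ⌢ a 1`. -/
def Homogeneous (d : List Bool → Bool) (l : List Bool) (a : Bool → List Bool) : Prop :=
  Incomp d (l ++ a false) (l ++ a true) ∨
    ∀ v v', ¬ Incomp d (l ++ a false ++ v) (l ++ a true ++ v')

lemma Homogeneous.append {d : List Bool → Bool} {l : List Bool} {a : Bool → List Bool}
    (h : Homogeneous d l a) (e : Bool → List Bool) :
    Homogeneous d l (fun b => a b ++ e b) := by
  rcases h with h | h
  · left
    simpa using h.append (e false) (e true)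
  · right
    intro v v'
    simpa using h (e false ++ v) (e true ++ v')

lemma IsLetter.append {a e : Bool → List Bool} (h : IsLetter a)
    (he : (e false).length = (e true).length) : IsLetter (fun b => a b ++ e b) :=
  ⟨by simp [h.1, he], fun h' => h.2 (List.append_inj h' h.1).1⟩

lemma exists_homogeneous_letter (d : List Bool → Bool) (L : List (List Bool)) :
    ∃ a, IsLetter a ∧ ∀ l ∈ L, Homogeneous d l a := by
  induction L with
  | nil => exact ⟨fun b => [b], by simp [IsLetter], by simp⟩
  | cons l L ih =>
    obtain ⟨a, ha, hL⟩ := ih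
    by_cases h : ∀ v v', ¬ Incomp d (l ++ a false ++ v) (l ++ a true ++ v')
    · exact ⟨a, ha, List.forall_mem_cons.2 ⟨Or.inr h, hL⟩⟩
    · push Not at h
      obtain ⟨v, v', h⟩ := h
      -- The two extensions are padded to a common length.
      let e : Bool → List Bool := fun b =>
        if b then v' ++ List.replicate v.length false else v ++ List.replicate v'.length false
      refine ⟨fun b => a b ++ e b, ha.append (by simp [e, add_comm]),
        List.forall_mem_cons.2 ⟨Or.inl ?_, fun l' hl' => (hL l' hl').append e⟩⟩
      simpa [e] using h.append (List.replicate v'.length false) (List.replicate v.length false)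

/-- There is a sequence of letters along which incomparability depends only on the place of
splitting. -/
lemma exists_splitting_homogeneous (d : List Bool → Bool) :
    ∃ t : ℕ → Bool → List Bool, (∀ k, IsLetter (t k)) ∧
      ∀ w : List Bool, Homogeneous d (subst t w) (t w.length) := by
  obtain ⟨t, -, -, ht, H⟩ := exists_fusion () (fun _ _ l a _ => Homogeneous d l a) (by
    intro _ _ L
    obtain ⟨a, ha, hL⟩ := exists_homogeneous_letter d L
    exact ⟨a, (), ha, hL⟩)
  exact ⟨t, ht, H⟩

lemma incomp_iff_of_split {d : List Bool → Bool} {t : ℕ → Bool → List Bool}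
    (H : ∀ w : List Bool, Homogeneous d (subst t w) (t w.length)) (l u u' : List Bool) :
    Incomp d (subst t (l ++ false :: u)) (subst t (l ++ true :: u')) ↔
      Incomp d (subst t l ++ t l.length false) (subst t l ++ t l.length true) := by
  have hs : ∀ b u, subst t (l ++ b :: u) =
      subst t l ++ t l.length b ++ subst (shift t (1 + l.length)) u := by
    intro b u
    simp [subst_append, subst_cons, shift_shift, shift]
  rw [hs, hs]
  constructor
  · intro h
    exact (H l).resolve_right fun h' => h' _ _ h
  · exact fun h => h.append _ _

/-- A symmetric relation on words which, for words that split after `l`, depends only on `l`, has no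
induced path on four words of equal length. -/
lemma no_path_of_splitting {R : List Bool → List Bool → Prop} {P : List Bool → Prop}
    (symm : ∀ v w, R v w → R w v) (irrefl : ∀ v, ¬ R v v)
    (split : ∀ l u u', R (l ++ false :: u) (l ++ true :: u') ↔ P l) :
    ∀ (w₁ w₂ w₃ w₄ l : List Bool), w₁.length = w₂.length → w₁.length = w₃.length →
      w₁.length = w₄.length → R (l ++ w₁) (l ++ w₂) → R (l ++ w₂) (l ++ w₃) →
      R (l ++ w₃) (l ++ w₄) → ¬ R (l ++ w₁) (l ++ w₃) → ¬ R (l ++ w₂) (l ++ w₄) →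
      ¬ R (l ++ w₁) (l ++ w₄) → False := by
  have split' : ∀ l u u', R (l ++ true :: u) (l ++ false :: u') ↔ P l := fun l u u' =>
    ⟨fun h => (split l u' u).1 (symm _ _ h), fun h => symm _ _ ((split l u' u).2 h)⟩
  intro w₁
  induction w₁ with
  | nil =>
    intro w₂ w₃ w₄ l h2 _ _ h _ _ _ _ _
    rw [List.length_eq_zero_iff.1 h2.symm] at h
    exact irrefl _ h
  | cons b₁ w₁ ih =>
    intro w₂ w₃ w₄ l h2 h3 h4 r12 r23 r34 n13 n24 n14
    match w₂, w₃, w₄, h2, h3, h4 with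
    | b₂ :: w₂, b₃ :: w₃, b₄ :: w₄, h2, h3, h4 =>
      by_cases hb : b₂ = b₁ ∧ b₃ = b₁ ∧ b₄ = b₁
      · obtain ⟨rfl, rfl, rfl⟩ := hb
        refine ih w₂ w₃ w₄ (l ++ [b₄]) (by simpa using h2) (by simpa using h3) (by simpa using h4)
          ?_ ?_ ?_ ?_ ?_ ?_ <;> simpa
      · -- Both the path and its complement are connected, so both have an edge that crosses the
        -- splitting at `l`.
        clear ih
        cases b₁ <;> cases b₂ <;> cases b₃ <;> cases b₄ <;>
          first
          | exact absurd ⟨rfl, rfl, rfl⟩ hb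
          | (simp only [split, split'] at r12 r23 r34 n13 n24 n14; contradiction)

/-! ### Willow trees -/

lemma getElem_initSeg (z : Cantor) (n i : ℕ) (h : i < (initSeg z n).length) :
    (initSeg z n)[i] = z i := by
  simp [initSeg]

lemma length_initSeg (z : Cantor) (n : ℕ) : (initSeg z n).length = n := by simp [initSeg]

/-- The willow tree with classes `A` and fixed values `f`. -/
def willow (A : Set (Finset ℕ)) (f : {n : ℕ // ∀ a ∈ A, n ∉ a} → Bool) : Set (List Bool) :=
  {u | (∀ (n : ℕ) (hn : ∀ a ∈ A, n ∉ a) (hu : n < u.length), u[n] = f ⟨n, hn⟩) ∧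
    ∀ a ∈ A, ∀ m ∈ a, ∀ n ∈ a, ∀ (hm : m < u.length) (hn : n < u.length), u[m] = u[n]}

lemma mem_branches_willow {A : Set (Finset ℕ)} {f : {n : ℕ // ∀ a ∈ A, n ∉ a} → Bool}
    {z : Cantor} : z ∈ branches (willow A f) ↔
      (∀ n (hn : ∀ a ∈ A, n ∉ a), z n = f ⟨n, hn⟩) ∧ ∀ a ∈ A, ∀ m ∈ a, ∀ n ∈ a, z m = z n := by
  constructor
  · intro h
    constructor
    · intro n hn
      have := (h (n + 1)).1 n hn (by simp [length_initSeg])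
      rwa [getElem_initSeg] at this
    · intro a ha m hm n hn
      have := (h (m + n + 1)).2 a ha m hm n hn (by rw [length_initSeg]; omega)
        (by rw [length_initSeg]; omega)
      rwa [getElem_initSeg, getElem_initSeg] at this
  · rintro ⟨h1, h2⟩ k
    refine ⟨fun n hn hu => ?_, fun a ha m hm n hn _ _ => ?_⟩
    · rw [getElem_initSeg, h1 n hn]
    · rw [getElem_initSeg, getElem_initSeg, h2 a ha m hm n hn]

/-- Only finitely many of a family of pairwise disjoint sets meet an initial segment of `ℕ`. -/
lemma infinite_sep_forall_le {A : Set (Finset ℕ)} (hA : A.Infinite)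
    (hd : A.PairwiseDisjoint id) (N : ℕ) : {a ∈ A | ∀ n ∈ a, N ≤ n}.Infinite := by
  have hfin : {a ∈ A | ∃ n ∈ a, n < N}.Finite := by
    have hch : ∀ a : Finset ℕ, ∃ n, (∃ n ∈ a, n < N) → n ∈ a ∧ n < N := by
      intro a
      by_cases h : ∃ n ∈ a, n < N
      · obtain ⟨n, hn⟩ := h
        exact ⟨n, fun _ => hn⟩
      · exact ⟨0, fun h' => absurd h' h⟩
    choose g hg using hch
    refine Set.Finite.of_injOn (f := g) (t := Set.Iio N) ?_ ?_ (Set.finite_Iio N)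
    · exact fun a ha => (hg a ha.2).2
    · intro a ha b hb hab
      by_contra hne
      refine Finset.disjoint_left.1 (hd ha.1 hb.1 hne) (hg a ha.2).1 ?_
      rw [hab]
      exact (hg b hb.2).1
  refine (hA.sdiff hfin).mono ?_
  rintro a ⟨ha, hn⟩
  refine ⟨ha, fun n hna => ?_⟩
  by_contra hlt
  exact hn ⟨ha, n, hna, not_le.1 hlt⟩

/-- A closed set which contains the branches of no willow tree is willow null. Closedness appears
in the form that each point outside the set has a neighbourhood outside the set. -/
lemma WillowNull.of_closed {C : Set Cantor}
    (closed : ∀ z ∉ C, ∃ N, ∀ z' : Cantor, (∀ i < N, z' i = z i) → z' ∉ C)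
    (h : ∀ T, IsWillowTree T → ¬ branches T ⊆ C) : WillowNull C := by
  intro T hT
  obtain ⟨z, hzT, hzC⟩ := Set.not_subset.1 (h T hT)
  obtain ⟨N, hN⟩ := closed z hzC
  obtain ⟨A, f, hA, hne, hd, rfl⟩ := hT
  change z ∈ branches (willow A f) at hzT
  obtain ⟨hz1, hz2⟩ := mem_branches_willow.1 hzT
  -- The classes which meet the first `N` indices are frozen to their values in `z`.
  set A' := {a ∈ A | ∀ n ∈ a, N ≤ n}
  have hA' : ∀ a ∈ A', a ∈ A := fun a ha => ha.1
  refine ⟨willow A' (fun n => z n.1), ⟨A', fun n => z n.1, infinite_sep_forall_le hA hd N,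
    fun a ha => hne a ha.1, hd.subset hA', rfl⟩, ?_, ?_⟩
  · rintro u ⟨hu1, hu2⟩
    refine ⟨fun n hn hu => ?_, fun a ha m hm n hn hmu hnu => ?_⟩
    · exact (hu1 n (fun a ha => hn a ha.1) hu).trans (hz1 n hn)
    · by_cases haA : a ∈ A'
      · exact hu2 a haA m hm n hn hmu hnu
      · have hout : ∀ k ∈ a, ∀ b ∈ A', k ∉ b := by
          intro k hk b hb hkb
          have hab : a ≠ b := fun hab => haA (hab ▸ hb)
          exact Finset.disjoint_left.1 (hd ha hb.1 hab) hk hkb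
        rw [hu1 m (hout m hm) hmu, hu1 n (hout n hn) hnu]
        exact hz2 a ha m hm n hn
  · rw [Set.disjoint_left]
    intro z' hz' hz'C
    refine hN z' (fun i hi => ?_) hz'C
    exact (mem_branches_willow.1 hz').1 i fun a ha hia => absurd (ha.2 i hia) (not_le.2 hi)

/-! ### The set of values of a name -/

/-- The closed set of sequences whose digits are read by `d` along words generated by `t`. -/
def valueSet (d : List Bool → Bool) (t : ℕ → Bool → List Bool) : Set Cantor :=
  {z | ∀ m : ℕ, ∃ w : List Bool, w.length = m ∧
    ∀ i ≤ (subst t w).length, z i = d ((subst t w).take i)}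

lemma exists_nbhd_of_notMem_valueSet {d : List Bool → Bool} {t : ℕ → Bool → List Bool}
    (ht : ∀ k, IsLetter (t k)) {z : Cantor} (hz : z ∉ valueSet d t) :
    ∃ N, ∀ z' : Cantor, (∀ i < N, z' i = z i) → z' ∉ valueSet d t := by
  simp only [valueSet, Set.mem_ofPred_eq, not_forall] at hz
  obtain ⟨m, hm⟩ := hz
  refine ⟨(subst t (List.replicate m false)).length + 1, fun z' hz' hC => hm ?_⟩
  obtain ⟨w, hw, hwz⟩ := hC m
  refine ⟨w, hw, fun i hi => ?_⟩
  rw [← hwz i hi]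
  refine (hz' i ?_).symm
  rw [length_subst_eq ht (w := w) (by simp [hw])]
  omega

/-- Four points of the set of values cannot form an induced path of incomparability. Comparability
is stated in a directed form. -/
lemma no_path_in_valueSet {d : List Bool → Bool} {t : ℕ → Bool → List Bool}
    (ht : ∀ k, IsLetter (t k)) (H : ∀ w : List Bool, Homogeneous d (subst t w) (t w.length))
    {z₁ z₂ z₃ z₄ : Cantor} (h₁ : z₁ ∈ valueSet d t) (h₂ : z₂ ∈ valueSet d t)
    (h₃ : z₃ ∈ valueSet d t) (h₄ : z₄ ∈ valueSet d t)
    (n12 : ¬ z₁ ≤ z₂) (n21 : ¬ z₂ ≤ z₁) (n23 : ¬ z₂ ≤ z₃) (n32 : ¬ z₃ ≤ z₂)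
    (n34 : ¬ z₃ ≤ z₄) (n43 : ¬ z₄ ≤ z₃) (l13 : z₁ ≤ z₃) (l24 : z₂ ≤ z₄) (l14 : z₁ ≤ z₄) :
    False := by
  have wit : ∀ z z' : Cantor, ¬ z ≤ z' → ∃ i, z i = true ∧ z' i = false := by
    intro z z' h
    rw [Pi.le_def, not_forall] at h
    obtain ⟨i, hi⟩ := h
    refine ⟨i, ?_⟩
    revert hi
    cases z i <;> cases z' i <;> simp
  obtain ⟨i1, a1, b1⟩ := wit _ _ n12
  obtain ⟨i2, a2, b2⟩ := wit _ _ n21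
  obtain ⟨i3, a3, b3⟩ := wit _ _ n23
  obtain ⟨i4, a4, b4⟩ := wit _ _ n32
  obtain ⟨i5, a5, b5⟩ := wit _ _ n34
  obtain ⟨i6, a6, b6⟩ := wit _ _ n43
  -- A level by which all the incomparabilities are witnessed.
  set m := i1 + i2 + i3 + i4 + i5 + i6
  obtain ⟨w₁, hw₁, e₁⟩ := h₁ m
  obtain ⟨w₂, hw₂, e₂⟩ := h₂ m
  obtain ⟨w₃, hw₃, e₃⟩ := h₃ m
  obtain ⟨w₄, hw₄, e₄⟩ := h₄ m
  have inc : ∀ {z z' : Cantor} {w w' : List Bool} {i j : ℕ},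
      (∀ k ≤ (subst t w).length, z k = d ((subst t w).take k)) →
      (∀ k ≤ (subst t w').length, z' k = d ((subst t w').take k)) →
      w.length = m → w'.length = m → i ≤ m → j ≤ m → z i = true → z' i = false →
      z' j = true → z j = false → Incomp d (subst t w) (subst t w') := by
    intro z z' w w' i j e e' hw hw' hi hj q1 q2 q3 q4
    have g := length_le_length_subst ht w
    have g' := length_le_length_subst ht w'
    rw [hw] at g
    rw [hw'] at g'
    rw [e i (by omega)] at q1
    rw [e' i (by omega)] at q2
    rw [e' j (by omega)] at q3
    rw [e j (by omega)] at q4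
    exact ⟨i, j, ⟨by omega, by omega, q1, q2⟩, ⟨by omega, by omega, q4, q3⟩⟩
  have cmp : ∀ {z z' : Cantor} {w w' : List Bool},
      (∀ k ≤ (subst t w).length, z k = d ((subst t w).take k)) →
      (∀ k ≤ (subst t w').length, z' k = d ((subst t w').take k)) →
      z ≤ z' → ¬ Incomp d (subst t w) (subst t w') := by
    rintro z z' w w' e e' hle ⟨i, -, ⟨q1, q2, q3, q4⟩, -⟩
    have := hle i
    rw [e i q1, e' i q2, q3, q4] at this
    exact Bool.false_ne_true (Bool.le_iff_imp.1 this rfl)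
  refine no_path_of_splitting (R := fun v w => Incomp d (subst t v) (subst t w))
    (fun v w h => h.symm) (fun v => Incomp.irrefl) (incomp_iff_of_split H) w₁ w₂ w₃ w₄ []
    (by rw [hw₁, hw₂]) (by rw [hw₁, hw₃]) (by rw [hw₁, hw₄]) ?_ ?_ ?_ ?_ ?_ ?_
  · exact inc e₁ e₂ hw₁ hw₂ (by omega) (by omega) a1 b1 a2 b2
  · exact inc e₂ e₃ hw₂ hw₃ (by omega) (by omega) a3 b3 a4 b4
  · exact inc e₃ e₄ hw₃ hw₄ (by omega) (by omega) a5 b5 a6 b6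
  · exact cmp e₁ e₃ l13
  · exact cmp e₂ e₄ l24
  · exact cmp e₁ e₄ l14

open Classical in
lemma willowNull_valueSet {d : List Bool → Bool} {t : ℕ → Bool → List Bool}
    (ht : ∀ k, IsLetter (t k)) (H : ∀ w : List Bool, Homogeneous d (subst t w) (t w.length)) :
    WillowNull (valueSet d t) := by
  refine WillowNull.of_closed (fun z hz => exists_nbhd_of_notMem_valueSet ht hz) ?_
  rintro T ⟨A, f, hA, hne, hd, rfl⟩ hsub
  change branches (willow A f) ⊆ _ at hsub
  have e := hA.natEmbedding
  -- The branch which is `1` on the classes `e j` with `j ∈ J`, and `0` on all others.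
  let z : Set ℕ → Cantor := fun J n =>
    if hn : ∀ a ∈ A, n ∉ a then f ⟨n, hn⟩ else decide (∃ j ∈ J, n ∈ (e j).1)
  have hval : ∀ J j n, n ∈ (e j).1 → z J n = decide (j ∈ J) := by
    intro J j n hn
    have h1 : ¬ ∀ a ∈ A, n ∉ a := fun h => h _ (e j).2 hn
    have h2 : (∃ k ∈ J, n ∈ (e k).1) ↔ j ∈ J := by
      refine ⟨?_, fun hj => ⟨j, hj, hn⟩⟩
      rintro ⟨k, hk, hnk⟩
      by_contra hj
      have hkj : (e k).1 ≠ (e j).1 := fun h => hj ((e.injective (Subtype.ext h)) ▸ hk)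
      exact Finset.disjoint_left.1 (hd (e k).2 (e j).2 hkj) hnk hn
    simp only [z, h1, dite_false, h2]
  have hz : ∀ J, z J ∈ valueSet d t := by
    intro J
    refine hsub (mem_branches_willow.2 ⟨fun n hn => by simp only [z]; rw [dif_pos hn], ?_⟩)
    intro a ha m hm n hn
    have h1 : ¬ ∀ a ∈ A, m ∉ a := fun h => h a ha hm
    have h2 : ¬ ∀ a ∈ A, n ∉ a := fun h => h a ha hn
    have h3 : ∀ k, m ∈ (e k).1 ↔ n ∈ (e k).1 := by
      intro k
      by_cases hk : (e k).1 = a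
      · simp [hk, hm, hn]
      · have := Finset.disjoint_left.1 (hd ha (e k).2 (Ne.symm hk))
        exact iff_of_false (this hm) (this hn)
    simp only [z, h1, h2, dite_false, h3]
  have hle : ∀ J K : Set ℕ, J ⊆ K → z J ≤ z K := by
    intro J K hJK n
    by_cases hn : ∀ a ∈ A, n ∉ a
    · simp only [z]
      rw [dif_pos hn, dif_pos hn]
    · simp only [z, hn, dite_false]
      rw [Bool.le_iff_imp]
      simp only [decide_eq_true_eq]
      rintro ⟨j, hj, hnj⟩
      exact ⟨j, hJK hj, hnj⟩
  have hnle : ∀ (j : ℕ) (J K : Set ℕ), j ∈ J → j ∉ K → ¬ z J ≤ z K := by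
    intro j J K hJ hK h
    obtain ⟨n, hn⟩ := hne _ (e j).2
    have := h n
    rw [hval J j n hn, hval K j n hn] at this
    simp [hJ, hK, Bool.le_iff_imp] at this
  exact no_path_in_valueSet ht H (hz {1}) (hz {0}) (hz {1, 2}) (hz {0, 1})
    (hnle 1 _ _ (by simp) (by simp)) (hnle 0 _ _ (by simp) (by simp))
    (hnle 0 _ _ (by simp) (by simp)) (hnle 1 _ _ (by simp) (by simp))
    (hnle 2 _ _ (by simp) (by simp)) (hnle 0 _ _ (by simp) (by simp))
    (hle _ _ (by simp)) (hle _ _ (by simp)) (hle _ _ (by simp))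

/-! ### Codes and forcing -/

/-- The code of a countable intersection. -/
def BorelCode.iInter (c : ℕ → BorelCode) : BorelCode := .compl (.iUnion fun n => .compl (c n))

lemma BorelCode.decode_iInter (c : ℕ → BorelCode) :
    (BorelCode.iInter c).decode = ⋂ n, (c n).decode := by
  simp [BorelCode.iInter, BorelCode.decode, Set.compl_iUnion]

/-- To force membership in a countable intersection it is enough that membership in each of the
sets is forced densely. -/
lemma forcesMem_iInter {P : Type} [Preorder P] {x : CantorName P} {c : ℕ → BorelCode} {p : P}
    (h : ∀ n, ∀ q ≤ p, ∃ r ≤ q, ForcesMem x (c n) r) : ForcesMem x (.iInter c) p := by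
  intro q hq hf
  obtain ⟨r, hr, n, hn⟩ := hf q le_rfl
  obtain ⟨r', hr', hr''⟩ := h n r (hr.trans hq)
  exact hn r' hr' hr''

lemma forcesMem_coord {P : Type} [Preorder P] {x : CantorName P} {n : ℕ} {b : Bool} {p a : P}
    (ha : a ∈ x.val n b) (h : p ≤ a) : ForcesMem x (.coord n b) p :=
  fun q hq => ⟨q, le_rfl, a, ha, hq.trans h⟩

/-- A code of the set of sequences with digits read by `d` along `v`. Indices beyond the length
of `v` are sent back to that length, so that they add no requirement. -/
def boxCode (d : List Bool → Bool) (v : List Bool) : BorelCode :=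
  .iInter fun i => .coord (min i v.length) (d (v.take (min i v.length)))

lemma decode_boxCode (d : List Bool → Bool) (v : List Bool) :
    (boxCode d v).decode = {z | ∀ i ≤ v.length, z i = d (v.take i)} := by
  ext z
  simp only [boxCode, BorelCode.decode_iInter, BorelCode.decode, Set.mem_iInter, Set.mem_ofPred_eq]
  constructor
  · intro h i hi
    simpa [min_eq_left hi] using h i
  · exact fun h i => h _ (min_le_right _ _)

lemma exists_enum_words (m : ℕ) :
    ∃ e : ℕ → List Bool, (∀ j, (e j).length = m) ∧ ∀ w : List Bool, w.length = m → ∃ j, e j = w := by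
  have : Nonempty {w : List Bool // w.length = m} := ⟨⟨List.replicate m false, by simp⟩⟩
  obtain ⟨e, he⟩ := exists_surjective_nat {w : List Bool // w.length = m}
  refine ⟨fun j => (e j).1, fun j => (e j).2, fun w hw => ?_⟩
  obtain ⟨j, hj⟩ := he ⟨w, hw⟩
  exact ⟨j, congrArg Subtype.val hj⟩

/-- The set of values has a Borel code, and membership in it is forced by a condition below which,
for each `m`, the digits along some word of length `m` are densely forced. -/
lemma exists_code_valueSet (d : List Bool → Bool) (t : ℕ → Bool → List Bool) :
    ∃ c : BorelCode, c.decode = valueSet d t ∧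
      ∀ {P : Type} [Preorder P] (x : CantorName P) (p : P),
        (∀ m : ℕ, ∀ q ≤ p, ∃ r ≤ q, ∃ w : List Bool, w.length = m ∧
          ∀ i ≤ (subst t w).length, ∃ a ∈ x.val i (d ((subst t w).take i)), r ≤ a) →
        ForcesMem x c p := by
  choose e he hes using exists_enum_words
  refine ⟨.iInter fun m => .iUnion fun j => boxCode d (subst t (e m j)), ?_, ?_⟩
  · ext z
    simp only [BorelCode.decode_iInter, BorelCode.decode, decode_boxCode, Set.mem_iInter,
      Set.mem_iUnion, valueSet, Set.mem_ofPred_eq]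
    refine forall_congr' fun m => ⟨?_, ?_⟩
    · rintro ⟨j, hj⟩
      exact ⟨_, he m j, hj⟩
    · rintro ⟨w, hw, h⟩
      obtain ⟨j, rfl⟩ := hes m w hw
      exact ⟨j, h⟩
  · intro P _ x p H
    refine forcesMem_iInter fun m q hq => ⟨q, le_rfl, fun q' hq' => ?_⟩
    obtain ⟨r, hr, w, hw, h⟩ := H m q' (hq'.trans hq)
    obtain ⟨j, rfl⟩ := hes m w hw
    refine ⟨r, hr, j, forcesMem_iInter fun i s hs => ⟨s, le_rfl, ?_⟩⟩
    obtain ⟨a, ha, hra⟩ := h _ (min_le_right i _)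
    exact forcesMem_coord ha (hs.trans hra)

/-- Letters of letters: an `E₀` tree of words in the letters `τ` is an `E₀` tree. -/
lemma exists_comp_letters {τ t : ℕ → Bool → List Bool} (hτ : ∀ k, IsLetter (τ k))
    (ht : ∀ k, IsLetter (t k)) :
    ∃ t' : ℕ → Bool → List Bool, (∀ k, IsLetter (t' k)) ∧
      ∀ w, subst t' w = subst τ (subst t w) := by
  let off : ℕ → ℕ := fun k => (subst t (List.replicate k false)).length
  have hoff : ∀ w : List Bool, (subst t w).length = off w.length := fun w =>
    length_subst_eq ht (by simp)
  refine ⟨fun k b => subst (shift τ (off k)) (t k b), fun k => ⟨?_, ?_⟩, fun w => ?_⟩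
  · exact length_subst_eq (IsLetter.shift hτ _) (ht k).1
  · exact fun h => (ht k).2 (subst_injective (IsLetter.shift hτ _) (ht k).1 h)
  · induction w using List.reverseRecOn with
    | nil => simp [subst_nil]
    | append_singleton w b ih =>
      have hlast : ∀ s : ℕ → Bool → List Bool, subst s (w ++ [b]) = subst s w ++ s w.length b := by
        intro s
        simp [subst_append, subst_cons, subst_nil, shift]
      rw [hlast, hlast, subst_append, ih, hoff]

end E0Willow

open E0Willow in
theorem mainTheorem10 : ¬ E0Willow.AddsQuasiGeneric E0Willow.E0Forcing E0Willow.WillowNull := by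
  rintro ⟨x, p, hp⟩
  obtain ⟨τ, d, hτ, hτp, hd⟩ := exists_continuous_reading x p
  obtain ⟨t, ht, H⟩ := exists_splitting_homogeneous d
  obtain ⟨t', ht', hcomp⟩ := exists_comp_letters hτ ht
  obtain ⟨c, hc, hforce⟩ := exists_code_valueSet d t
  have hcone : ∀ (w : List Bool) (i : ℕ), i ≤ (subst t w).length →
      tree (subst t' w) (shift t' w.length) ⊆
        tree (subst τ ((subst t w).take i)) (shift τ i) := by
    intro w i hi
    rw [tree_subset_iff]
    intro v
    have hlen : ((subst t w).take i).length = i := by simpa using hi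
    refine ⟨(subst t w).drop i ++ subst (shift t w.length) v, ?_⟩
    calc subst t' w ++ subst (shift t' w.length) v
        = subst τ (subst t w ++ subst (shift t w.length) v) := by
          rw [← subst_append, hcomp, subst_append]
      _ = subst τ ((subst t w).take i ++
            ((subst t w).drop i ++ subst (shift t w.length) v)) := by
          rw [← List.append_assoc, List.take_append_drop]
      _ <+: _ := by rw [subst_append, hlen]
  have hsub : tree [] t' ⊆ tree [] τ := by
    simpa [subst_nil, shift_zero] using hcone [] 0 (by simp)
  let q : E0Forcing := ⟨tree [] t', isE0Tree_tree ht'⟩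
  have hqp : q ≤ p := hsub.trans hτp
  refine hp c (by rw [hc]; exact willowNull_valueSet ht H) q hqp (hforce x q ?_)
  intro m q' hq'
  obtain ⟨r, hr, hrq, w, hw, hrw⟩ := exists_subset_cone ht' m q'.2 hq'
  refine ⟨⟨r, hr⟩, hrq, w, hw, fun i hi => ?_⟩
  have hlen : ((subst t w).take i).length = i := by simpa using hi
  obtain ⟨a, ha, hsa⟩ := hd ((subst t w).take i)
  rw [hlen] at ha hsa
  subst hw
  exact ⟨a, ha, (hrw.trans (hcone w i hi)).trans hsa⟩
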